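/- Let $d\ge 2$ be an integer, $\omega=e^{2\pi i/d}$, and for $n\ge 2$ consider $n$ qudits with Hilbert space $(\mathbb C^d)^{\otimes n}$ and computational basis $|q_1\dots q_n\rangle$, $q_i\in\{0,\dots,d-1\}$. The elementary hypergraph state on $n$ qudits with hyperedge multiplicity $m$ is $$|G_n^{m}\rangle = Z_e^{m}\,|+\rangle^{\otimes n}=\frac{1}{\sqrt{d^n}}\sum_{q_1,\dots,q_n=0}^{d-1}\omega^{m\,q_1\cdots q_n}\,|q_1\dots q_n\rangle ,$$ where $|+\rangle=d^{-1/2}\sum_{q}|q\rangle$ and $Z_e|q_1\dots q_n\rangle=\omega^{q_1\cdots q_n}|q_1\dots q_n\rangle$. For a unit vector $|\psi\rangle\in(\mathbb C^d)^{\otimes n}$ the multipartite entanglement is $$E(|\psi\rangle)=\min_{A\sqcup B=\{1,\dots,n\},\;A,B\ne\emptyset}\Bigl(1-\max_{|\phi^A\rangle,|\phi^B\rangle}\bigl|(\langle\phi^A|\langle\phi^B|)|\psi\rangle\bigr|^2\Bigr),$$ the maximum being over unit vectors $|\phi^A\rangle\in(\mathbb C^d)^{\otimes A}$ and $|\phi^B\rangle\in(\mathbb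 C^d)^{\otimes B}$. Then, for every multiplicity $m_e\in\mathbb N$ with $m_e\not\equiv 0 \pmod d$ and every $n\ge 2$, $$E\bigl(|G_{n+1}^{m_e}\rangle\bigr)<E\bigl(|G_n^{m_e}\rangle\bigr),$$ that is, for fixed $d$ and $m_e$ the multipartite entanglement of elementary hypergraph states is strictly decreasing in the number of qudits. -/

import Mathlib

noncomputable section

/-- The Hilbert space `⨂_{i ∈ ι} ℂ^d` of a family of qudits indexed by `ι`, in the computational
basis `|q⟩ = ⨂ |q i⟩`, `q : ι → {0, …, d-1}`. A pure state is a vector of norm one. -/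
abbrev QuditSpace (d : ℕ) (ι : Type*) : Type _ := EuclideanSpace ℂ (ι → Fin d)

/-- The primitive root of unity `ω = exp (2 π i / d)`. -/
def rootOmega (d : ℕ) : ℂ := Complex.exp (2 * Real.pi * Complex.I / d)

/-- The one-qudit state `|+⟩ = d^{-1/2} ∑_q |q⟩`. -/
def plusLocal (d : ℕ) : EuclideanSpace ℂ (Fin d) :=
  WithLp.toLp 2 fun _ => (((Real.sqrt d)⁻¹ : ℝ) : ℂ)

/-- The state `|+⟩^V = ⨂_{i ∈ V} |+⟩_i`. -/
def plusState (d : ℕ) (V : Type*) [Fintype V] : QuditSpace d V :=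
  WithLp.toLp 2 fun q => ∏ i, plusLocal d (q i)

/-- The controlled phase gate `Z_e = ∑_q ω^{∏_{i ∈ e} q_i} |q⟩⟨q|` on the qudits of `e ⊆ V`. -/
def controlledPhase (d : ℕ) {V : Type*} [Fintype V] [DecidableEq V] (e : Finset V) :
    QuditSpace d V →ₗ[ℂ] QuditSpace d V :=
  Matrix.toEuclideanLin
    (Matrix.diagonal fun q : V → Fin d => rootOmega d ^ (∏ i ∈ e, (q i : ℕ)))

/-- The elementary hypergraph state `|G_n^m⟩ = Z_e^m |+⟩^V`, where `V` has `n` vertices and `e = V`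
is the single hyperedge, of multiplicity `m`. -/
def elementaryState (d n m : ℕ) : QuditSpace d (Fin n) :=
  (controlledPhase d (Finset.univ : Finset (Fin n)) ^ m) (plusState d (Fin n))

section Entanglement

variable {d : ℕ} {V : Type*} [Fintype V] [DecidableEq V]

/-- The vector `|φ^A⟩|φ^B⟩`, where `B` is the complement of `A`. -/
def tensorAcross (A : Finset V) (φA : QuditSpace d {i // i ∈ A})
    (φB : QuditSpace d {i // i ∉ A}) : QuditSpace d V :=
  WithLp.toLp 2 fun q => φA (fun i => q i) * φB (fun i => q i)

/-- The squared overlaps of `ψ` with the pure states separable with respect to `A`, `Aᶜ`. -/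
def overlapSet (A : Finset V) (ψ : QuditSpace d V) : Set ℝ :=
  {r | ∃ (φA : QuditSpace d {i // i ∈ A}) (φB : QuditSpace d {i // i ∉ A}),
    ‖φA‖ = 1 ∧ ‖φB‖ = 1 ∧ r = ‖inner ℂ (tensorAcross A φA φB) ψ‖ ^ 2}

/-- The maximum squared overlap `α^{AB}` (see `isGreatest_maxOverlap`: it is a maximum). -/
def maxOverlap (A : Finset V) (ψ : QuditSpace d V) : ℝ := sSup (overlapSet A ψ)

/-- The bipartite entanglement `E^{AB} = 1 - α^{AB}`. -/
def bipartiteEntanglement (A : Finset V) (ψ : QuditSpace d V) : ℝ := 1 - maxOverlap A ψ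

/-- The multipartite entanglement: the minimum of `E^{AB}` over all bipartitions of `V` into two
non-empty parts `A` and `B = Aᶜ` (a finite family, non-empty when `V` has at least two elements). -/
def multipartiteEntanglement (ψ : QuditSpace d V) : ℝ :=
  ⨅ A : {A : Finset V // A.Nonempty ∧ Aᶜ.Nonempty}, bipartiteEntanglement A.1 ψ

theorem isGreatest_maxOverlap (hd : 0 < d) (A : Finset V) (ψ : QuditSpace d V) :
    IsGreatest (overlapSet A ψ) (maxOverlap A ψ) := by
  have himg : overlapSet A ψ =
      (fun p : QuditSpace d {i // i ∈ A} × QuditSpace d {i // i ∉ A} =>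
        ‖inner ℂ (tensorAcross A p.1 p.2) ψ‖ ^ 2) ''
        (Metric.sphere 0 1 ×ˢ Metric.sphere 0 1) := by
    ext r
    constructor
    · rintro ⟨φA, φB, hA, hB, rfl⟩
      exact ⟨(φA, φB), ⟨by simpa using hA, by simpa using hB⟩, rfl⟩
    · rintro ⟨⟨φA, φB⟩, ⟨hA, hB⟩, rfl⟩
      exact ⟨φA, φB, by simpa using hA, by simpa using hB, rfl⟩
  have hcont : Continuous fun p : QuditSpace d {i // i ∈ A} × QuditSpace d {i // i ∉ A} =>
      ‖inner ℂ (tensorAcross A p.1 p.2) ψ‖ ^ 2 := by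
    have h : Continuous fun p : QuditSpace d {i // i ∈ A} × QuditSpace d {i // i ∉ A} =>
        tensorAcross A p.1 p.2 := by
      unfold tensorAcross
      fun_prop
    exact (h.inner continuous_const).norm.pow 2
  have hcpt : IsCompact (overlapSet A ψ) := by
    rw [himg]
    exact ((isCompact_sphere _ _).prod (isCompact_sphere _ _)).image hcont
  have hne : (overlapSet A ψ).Nonempty :=
    ⟨_, EuclideanSpace.single (fun _ => ⟨0, hd⟩) 1, EuclideanSpace.single (fun _ => ⟨0, hd⟩) 1,
      by simp, by simp, rfl⟩
  exact hcpt.isGreatest_sSup hne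

end Entanglement

end

/-!
Across a bipartition `A`, `B`, the maximal squared overlap is the largest eigenvalue of the reduced
density matrix on `B`. For the elementary state on `n` qudits, orthogonality of characters shows
that the entry of that matrix at basis states `y`, `z` of `B` is nonnegative: it is
`d ^ (-|B|)` times the proportion of tuples `x₁, …, x_{|A|-1}` of residues modulo `d` such that
`m (∏ z - ∏ y) x₁ ⋯ x_{|A|-1} = 0`. A further qudit on the side of `A` adds a factor to this
product, so no entry decreases, all become positive, and those with `m (∏ z - ∏ y) ≠ 0` strictly
increase. The largest eigenvalue of an entrywise positive symmetric matrix is strictly monotone in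
the entries (as in Perron–Frobenius), so each bipartition of `n` qudits is strictly more entangled
than the bipartition of `n + 1` qudits obtained by enlarging one side.
-/

open Matrix

section NonnegativeMatrix

theorem dotProduct_mulVec_le_of_le {m n R : Type*} [Fintype m] [Fintype n] [Semiring R]
    [PartialOrder R] [IsOrderedRing R] {K L : Matrix m n R} (hKL : ∀ i j, K i j ≤ L i j)
    {u : m → R} {v : n → R} (hu : 0 ≤ u) (hv : 0 ≤ v) : u ⬝ᵥ K *ᵥ v ≤ u ⬝ᵥ L *ᵥ v :=
  dotProduct_le_dotProduct_of_nonneg_left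
    (fun i => dotProduct_le_dotProduct_of_nonneg_right (hKL i) hv) hu

theorem dotProduct_mulVec_lt_of_lt {m n R : Type*} [Fintype m] [Fintype n] [Semiring R]
    [PartialOrder R] [IsStrictOrderedRing R] {K L : Matrix m n R} (hKL : ∀ i j, K i j ≤ L i j)
    {i₀ : m} {j₀ : n} (hlt : K i₀ j₀ < L i₀ j₀) {u : m → R} {v : n → R} (hu : ∀ i, 0 < u i)
    (hv : ∀ j, 0 < v j) : u ⬝ᵥ K *ᵥ v < u ⬝ᵥ L *ᵥ v := by
  have hrow : (K *ᵥ v) i₀ < (L *ᵥ v) i₀ :=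
    Finset.sum_lt_sum (fun j _ => mul_le_mul_of_nonneg_right (hKL i₀ j) (hv j).le)
      ⟨j₀, Finset.mem_univ _, mul_lt_mul_of_pos_right hlt (hv j₀)⟩
  have hrows : K *ᵥ v ≤ L *ᵥ v := fun i =>
    dotProduct_le_dotProduct_of_nonneg_right (hKL i) fun j => (hv j).le
  exact Finset.sum_lt_sum (fun i _ => mul_le_mul_of_nonneg_left (hrows i) (hu i).le)
    ⟨i₀, Finset.mem_univ _, mul_lt_mul_of_pos_left hrow (hu i₀)⟩

theorem mulVec_pos_of_pos {m n R : Type*} [Fintype n] [Semiring R] [PartialOrder R]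
    [IsStrictOrderedRing R] {L : Matrix m n R} (hL : ∀ i j, 0 < L i j) {v : n → R} (hv₀ : 0 ≤ v)
    (hv : v ≠ 0) (i : m) : 0 < (L *ᵥ v) i := by
  obtain ⟨j, hj⟩ := Function.ne_iff.1 hv
  exact Finset.sum_pos' (fun k _ => mul_nonneg (hL i k).le (hv₀ k))
    ⟨j, Finset.mem_univ j, mul_pos (hL i j) ((hv₀ j).lt_of_ne' hj)⟩

variable {κ R : Type*} [Fintype κ] [Field R] [LinearOrder R] [IsStrictOrderedRing R]

-- Moving `f` by `t` in a direction where it vanishes changes `f ⬝ᵥ f` only to second order in `t`,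
-- but increases the quadratic form to first order.
theorem exists_dotProduct_mulVec_gt_of_apply_eq_zero {L : Matrix κ κ R} (hL : ∀ i j, 0 < L i j)
    {f : κ → R} (hf₀ : 0 ≤ f) (hf : f ⬝ᵥ f = 1) {i : κ} (hi : f i = 0) :
    ∃ g : κ → R, f ⬝ᵥ L *ᵥ f * (g ⬝ᵥ g) < g ⬝ᵥ L *ᵥ g := by
  classical
  have hLf : 0 < (L *ᵥ f) i := mulVec_pos_of_pos hL hf₀ (by rintro rfl; simp at hf) i
  have hq : 0 ≤ f ⬝ᵥ L *ᵥ f :=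
    dotProduct_nonneg_of_nonneg hf₀ fun j => dotProduct_nonneg_of_nonneg (fun k => (hL j k).le) hf₀
  have hcol : 0 ≤ f ⬝ᵥ L.col i := dotProduct_nonneg_of_nonneg hf₀ fun j => (hL j i).le
  set q := f ⬝ᵥ L *ᵥ f
  set c := (L *ᵥ f) i
  set t := c / (q + 1) with ht
  have : 0 < t := by positivity
  have htq : t * (q + 1) = c := by rw [ht]; field_simp
  refine ⟨f + t • Pi.single i 1, ?_⟩
  have hnorm : (f + t • Pi.single i 1) ⬝ᵥ (f + t • Pi.single i 1) = 1 + t ^ 2 := by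
    simp [add_dotProduct, dotProduct_add, hf, hi, sq]
  have hform : (f + t • Pi.single i 1) ⬝ᵥ L *ᵥ (f + t • Pi.single i 1) =
      q + t * c + t * (f ⬝ᵥ L.col i) + t ^ 2 * L i i := by
    simp only [mulVec_add, mulVec_smul, mulVec_single, MulOpposite.op_one, one_smul, dotProduct_add,
      add_dotProduct, smul_dotProduct, single_dotProduct, one_mul, smul_eq_mul, dotProduct_smul,
      col_apply, q, c]
    ring
  rw [hnorm, hform]
  have := hL i i
  have : q * t ^ 2 + t ^ 2 = t * c := by rw [← htq]; ring
  have : 0 ≤ t * (f ⬝ᵥ L.col i) := by positivity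
  have : 0 < t ^ 2 * L i i := by positivity
  have : 0 < t ^ 2 := by positivity
  linarith

theorem exists_dotProduct_mulVec_lt_of_le {K L : Matrix κ κ R} (hKL : ∀ i j, K i j ≤ L i j)
    (hL : ∀ i j, 0 < L i j) {i₀ j₀ : κ} (hlt : K i₀ j₀ < L i₀ j₀) {f : κ → R} (hf₀ : 0 ≤ f)
    (hf : f ⬝ᵥ f = 1) : ∃ g : κ → R, f ⬝ᵥ K *ᵥ f * (g ⬝ᵥ g) < g ⬝ᵥ L *ᵥ g := by
  by_cases hzero : ∃ i, f i = 0
  · obtain ⟨i, hi⟩ := hzero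
    obtain ⟨g, hg⟩ := exists_dotProduct_mulVec_gt_of_apply_eq_zero hL hf₀ hf hi
    refine ⟨g, lt_of_le_of_lt ?_ hg⟩
    gcongr
    · exact Finset.sum_nonneg fun i _ => mul_self_nonneg (g i)
    · exact dotProduct_mulVec_le_of_le hKL hf₀ hf₀
  · have hpos : ∀ i, 0 < f i := fun i => (hf₀ i).lt_of_ne' fun hi => hzero ⟨i, hi⟩
    exact ⟨f, by simpa [hf] using dotProduct_mulVec_lt_of_lt hKL hlt hpos hpos⟩

end NonnegativeMatrix

section AnnihilatorCount

/-- The number of tuples `(z₁, …, z_a)` with `s z₁ ⋯ z_a = 0`. By orthogonality of characters it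
evaluates the exponential sum of `s x₁ ⋯ x_{a+1}`. -/
def annihilatorCount {M : Type*} [CommMonoidWithZero M] [Fintype M] [DecidableEq M] (a : ℕ)
    (s : M) : ℕ :=
  Finset.card {z : Fin a → M | s * ∏ i, z i = 0}

section MonoidWithZero

variable {M : Type*} [CommMonoidWithZero M] [Fintype M] [DecidableEq M]

theorem annihilatorCount_succ (a : ℕ) (s : M) :
    annihilatorCount (a + 1) s =
      ∑ z : Fin a → M, Finset.card {w : M | s * (∏ i, z i) * w = 0} := by
  simp only [annihilatorCount, Finset.card_filter]
  rw [← (Fin.snocEquiv fun _ => M).sum_comp, Fintype.sum_prod_type_right]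
  simp [Fin.prod_univ_castSucc, Fin.snocEquiv, mul_assoc]

theorem annihilatorCount_succ_pos (a : ℕ) (s : M) : 0 < annihilatorCount (a + 1) s :=
  Finset.card_pos.2 ⟨0, by simp⟩

theorem card_mul_annihilatorCount (a : ℕ) (s : M) :
    Fintype.card M * annihilatorCount a s =
      ∑ z : Fin a → M, if s * ∏ i, z i = 0 then Fintype.card M else 0 := by
  rw [annihilatorCount, Finset.card_filter, Finset.mul_sum]
  simp

theorem ite_card_le_card_filter_mul_eq_zero (s : M) :
    (if s = 0 then Fintype.card M else 0) ≤ Finset.card {w : M | s * w = 0} := by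
  split_ifs with hs <;> simp [hs]

theorem card_mul_annihilatorCount_le_succ (a : ℕ) (s : M) :
    Fintype.card M * annihilatorCount a s ≤ annihilatorCount (a + 1) s := by
  rw [card_mul_annihilatorCount, annihilatorCount_succ]
  exact Finset.sum_le_sum fun z _ => ite_card_le_card_filter_mul_eq_zero _

theorem card_mul_annihilatorCount_lt_succ (a : ℕ) {s : M} (hs : s ≠ 0) :
    Fintype.card M * annihilatorCount a s < annihilatorCount (a + 1) s := by
  rw [card_mul_annihilatorCount, annihilatorCount_succ]
  refine Finset.sum_lt_sum (fun z _ => ite_card_le_card_filter_mul_eq_zero _)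
    ⟨1, Finset.mem_univ _, ?_⟩
  simpa [hs] using Finset.card_pos.2 ⟨0, by simp⟩

end MonoidWithZero

theorem sum_addChar_mul_prod {R R' : Type*} [CommRing R] [Fintype R] [DecidableEq R] [CommRing R']
    [IsDomain R'] {χ : AddChar R R'} (hχ : χ.IsPrimitive) (a : ℕ) (s : R) :
    ∑ x : Fin (a + 1) → R, χ (s * ∏ i, x i) = Fintype.card R * annihilatorCount a s := by
  have hlast (z : Fin a → R) : ∑ w, χ (s * ((∏ i, z i) * w)) =
      ((if s * ∏ i, z i = 0 then Fintype.card R else 0 : ℕ) : R') := by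
    rw [← AddChar.sum_mulShift _ hχ]
    exact Finset.sum_congr rfl fun w _ => by rw [← mul_assoc, mul_comm]
  rw [← Nat.cast_mul, card_mul_annihilatorCount, Nat.cast_sum,
    ← (Fin.snocEquiv fun _ => R).sum_comp, Fintype.sum_prod_type_right]
  simp only [Fin.snocEquiv, Equiv.coe_fn_mk, Fin.prod_univ_castSucc, Fin.snoc_castSucc,
    Fin.snoc_last, hlast]

end AnnihilatorCount

theorem norm_toLp_mulVec_sq {𝕜 m n : Type*} [RCLike 𝕜] [Fintype m] [Fintype n] (M : Matrix m n 𝕜)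
    (v : n → 𝕜) :
    ((‖WithLp.toLp 2 (M *ᵥ v)‖ ^ 2 : ℝ) : 𝕜) = star v ⬝ᵥ (Mᴴ * M) *ᵥ v := by
  rw [RCLike.ofReal_pow, ← inner_self_eq_norm_sq_to_K, EuclideanSpace.inner_toLp_toLp,
    dotProduct_comm, star_mulVec, ← dotProduct_mulVec, mulVec_mulVec]

theorem norm_dotProduct_mulVec_le {𝕜 m n : Type*} [NormedRing 𝕜] [Fintype m] [Fintype n]
    (M : Matrix m n 𝕜) (u : m → 𝕜) (v : n → 𝕜) :
    ‖u ⬝ᵥ M *ᵥ v‖ ≤ (fun i => ‖u i‖) ⬝ᵥ M.map norm *ᵥ fun j => ‖v j‖ := by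
  refine (norm_sum_le _ _).trans (Finset.sum_le_sum fun i _ => (norm_mul_le _ _).trans ?_)
  refine mul_le_mul_of_nonneg_left ?_ (norm_nonneg _)
  exact (norm_sum_le _ _).trans (Finset.sum_le_sum fun j _ => norm_mul_le _ _)

section Bipartition

theorem tensorAcross_smul_smul {d : ℕ} {V : Type*} (A : Finset V) (a b : ℂ)
    (φA : QuditSpace d {i // i ∈ A}) (φB : QuditSpace d {i // i ∉ A}) :
    tensorAcross A (a • φA) (b • φB) = (a * b) • tensorAcross A φA φB := by
  ext q
  simp only [tensorAcross, PiLp.smul_apply, smul_eq_mul]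
  ring

variable {d : ℕ} {V : Type*} [Fintype V] [DecidableEq V]

/-- The coefficients of `ψ` arranged as a matrix, with rows indexed by the basis states of `A` and
columns by those of the complementary qudits. -/
def coeffMatrix (A : Finset V) (ψ : QuditSpace d V) :
    Matrix ({i // i ∈ A} → Fin d) ({i // i ∉ A} → Fin d) ℂ :=
  Matrix.of fun x y => ψ ((Equiv.piEquivPiSubtypeProd (· ∈ A) fun _ => Fin d).symm (x, y))

/-- The complex conjugate (equivalently, the transpose) of the reduced density matrix of `ψ` on the
qudits outside `A`. Conjugating leaves the spectrum unchanged and makes it a Gram matrix `Mᴴ M`. -/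
def reducedGram (A : Finset V) (ψ : QuditSpace d V) :
    Matrix ({i // i ∉ A} → Fin d) ({i // i ∉ A} → Fin d) ℂ :=
  (coeffMatrix A ψ)ᴴ * coeffMatrix A ψ

theorem inner_tensorAcross (A : Finset V) (φA : QuditSpace d {i // i ∈ A})
    (φB : QuditSpace d {i // i ∉ A}) (ψ : QuditSpace d V) :
    inner ℂ (tensorAcross A φA φB) ψ =
      inner ℂ φA (WithLp.toLp 2 (coeffMatrix A ψ *ᵥ star φB.ofLp)) := by
  simp only [PiLp.inner_apply, RCLike.inner_apply', tensorAcross, coeffMatrix, mulVec, dotProduct]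
  rw [← (Equiv.piEquivPiSubtypeProd (· ∈ A) fun _ => Fin d).symm.sum_comp, Fintype.sum_prod_type]
  refine Finset.sum_congr rfl fun x _ => ?_
  rw [Finset.mul_sum]
  refine Finset.sum_congr rfl fun y _ => ?_
  have hx : (fun i : {i // i ∈ A} =>
      (Equiv.piEquivPiSubtypeProd (· ∈ A) fun _ => Fin d).symm (x, y) i) = x := by
    ext i; simp
  have hy : (fun i : {i // i ∉ A} =>
      (Equiv.piEquivPiSubtypeProd (· ∈ A) fun _ => Fin d).symm (x, y) i) = y := by
    ext i; simp [i.2]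
  simp only [hx, hy, map_mul, of_apply, Pi.star_apply, RCLike.star_def]
  ring

variable [NeZero d]

theorem maxOverlap_nonneg (A : Finset V) (ψ : QuditSpace d V) : 0 ≤ maxOverlap A ψ := by
  obtain ⟨φA, φB, -, -, h⟩ := (isGreatest_maxOverlap (NeZero.pos d) A ψ).1
  exact h ▸ sq_nonneg _

theorem exists_maxOverlap_le_norm_mulVec_sq (A : Finset V) (ψ : QuditSpace d V) :
    ∃ v : ({i // i ∉ A} → Fin d) → ℂ, ‖WithLp.toLp 2 v‖ = 1 ∧
      maxOverlap A ψ ≤ ‖WithLp.toLp 2 (coeffMatrix A ψ *ᵥ v)‖ ^ 2 := by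
  obtain ⟨φA, φB, hA, hB, h⟩ := (isGreatest_maxOverlap (NeZero.pos d) A ψ).1
  refine ⟨star φB.ofLp, by simpa [EuclideanSpace.norm_eq] using hB, ?_⟩
  rw [h, inner_tensorAcross]
  gcongr
  simpa [hA] using norm_inner_le_norm (𝕜 := ℂ) φA _

theorem norm_inner_tensorAcross_sq_le (A : Finset V) (φA : QuditSpace d {i // i ∈ A})
    (φB : QuditSpace d {i // i ∉ A}) (ψ : QuditSpace d V) :
    ‖inner ℂ (tensorAcross A φA φB) ψ‖ ^ 2 ≤ maxOverlap A ψ * (‖φA‖ * ‖φB‖) ^ 2 := by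
  by_cases hA : φA = 0
  · simp [hA, inner_tensorAcross]
  by_cases hB : φB = 0
  · simp [hB, inner_tensorAcross]
  have : 0 < ‖φA‖ := norm_pos_iff.2 hA
  have : 0 < ‖φB‖ := norm_pos_iff.2 hB
  rw [← div_le_iff₀ (by positivity), ← div_pow]
  refine (isGreatest_maxOverlap (NeZero.pos d) A ψ).2
    ⟨(‖φA‖⁻¹ : ℂ) • φA, (‖φB‖⁻¹ : ℂ) • φB, norm_smul_inv_norm hA, norm_smul_inv_norm hB, ?_⟩
  rw [tensorAcross_smul_smul, inner_smul_left, norm_mul]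
  simp only [map_mul, map_inv₀, Complex.conj_ofReal, norm_mul, norm_inv, Complex.norm_real,
    norm_norm]
  rw [← mul_inv, div_eq_inv_mul]

theorem norm_mulVec_sq_le_maxOverlap_mul (A : Finset V) (ψ : QuditSpace d V)
    (v : ({i // i ∉ A} → Fin d) → ℂ) :
    ‖WithLp.toLp 2 (coeffMatrix A ψ *ᵥ v)‖ ^ 2 ≤ maxOverlap A ψ * ‖WithLp.toLp 2 v‖ ^ 2 := by
  set w := WithLp.toLp 2 (coeffMatrix A ψ *ᵥ v) with hw
  by_cases hw₀ : w = 0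
  · rw [hw₀, norm_zero, zero_pow two_ne_zero]
    exact mul_nonneg (maxOverlap_nonneg A ψ) (sq_nonneg _)
  have hstar : ‖WithLp.toLp 2 (star v)‖ = ‖WithLp.toLp 2 v‖ := by simp [EuclideanSpace.norm_eq]
  have hbound := norm_inner_tensorAcross_sq_le A w (WithLp.toLp 2 (star v)) ψ
  rw [inner_tensorAcross, star_star, ← hw, inner_self_eq_norm_sq_to_K, norm_pow, RCLike.norm_ofReal,
    abs_norm, hstar] at hbound
  have hpos : 0 < ‖w‖ ^ 2 := pow_pos (norm_pos_iff.2 hw₀) 2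
  refine le_of_mul_le_mul_right ?_ hpos
  linarith

theorem exists_maxOverlap_le_dotProduct_reducedGram (A : Finset V) (ψ : QuditSpace d V) :
    ∃ f : ({i // i ∉ A} → Fin d) → ℝ, 0 ≤ f ∧ f ⬝ᵥ f = 1 ∧
      maxOverlap A ψ ≤ f ⬝ᵥ (reducedGram A ψ).map norm *ᵥ f := by
  obtain ⟨v, hv, hle⟩ := exists_maxOverlap_le_norm_mulVec_sq A ψ
  refine ⟨fun y => ‖v y‖, fun y => norm_nonneg _, ?_, ?_⟩
  · rw [← one_pow 2, ← hv, EuclideanSpace.norm_sq_eq]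
    simp [dotProduct, sq]
  calc maxOverlap A ψ ≤ ‖WithLp.toLp 2 (coeffMatrix A ψ *ᵥ v)‖ ^ 2 := hle
    _ = ‖star v ⬝ᵥ reducedGram A ψ *ᵥ v‖ := by
      rw [reducedGram, ← norm_toLp_mulVec_sq, RCLike.norm_ofReal, abs_of_nonneg (sq_nonneg _)]
    _ ≤ _ := by simpa using norm_dotProduct_mulVec_le (reducedGram A ψ) (star v) v

theorem dotProduct_mulVec_le_maxOverlap_mul {A : Finset V} {ψ : QuditSpace d V}
    {L : Matrix ({i // i ∉ A} → Fin d) ({i // i ∉ A} → Fin d) ℝ}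
    (hL : reducedGram A ψ = L.map Complex.ofReal) (g : ({i // i ∉ A} → Fin d) → ℝ) :
    g ⬝ᵥ L *ᵥ g ≤ maxOverlap A ψ * (g ⬝ᵥ g) := by
  have hnorm : ‖WithLp.toLp 2 fun y => (g y : ℂ)‖ ^ 2 = g ⬝ᵥ g := by
    rw [EuclideanSpace.norm_sq_eq]
    simp [dotProduct, sq]
  have hform : ‖WithLp.toLp 2 (coeffMatrix A ψ *ᵥ fun y => (g y : ℂ))‖ ^ 2 = g ⬝ᵥ L *ᵥ g := by
    apply Complex.ofReal_injective
    refine (norm_toLp_mulVec_sq _ _).trans ?_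
    rw [← reducedGram, hL]
    simp [dotProduct, mulVec]
  rw [← hform, ← hnorm]
  exact norm_mulVec_sq_le_maxOverlap_mul A ψ _

theorem maxOverlap_lt_of_reducedGram_lt {W : Type*} [Fintype W] [DecidableEq W] {A : Finset V}
    {A' : Finset W} {ψ : QuditSpace d V} {ψ' : QuditSpace d W}
    (e : ({i // i ∉ A} → Fin d) ≃ ({i // i ∉ A'} → Fin d))
    {L : Matrix ({i // i ∉ A'} → Fin d) ({i // i ∉ A'} → Fin d) ℝ}
    (hψ' : reducedGram A' ψ' = L.map Complex.ofReal) (hL : ∀ y z, 0 < L y z)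
    (hle : ∀ y z, ‖reducedGram A ψ y z‖ ≤ L (e y) (e z)) {y₀ z₀ : {i // i ∉ A} → Fin d}
    (hlt : ‖reducedGram A ψ y₀ z₀‖ < L (e y₀) (e z₀)) :
    maxOverlap A ψ < maxOverlap A' ψ' := by
  obtain ⟨f, hf₀, hf, hmax⟩ := exists_maxOverlap_le_dotProduct_reducedGram A ψ
  obtain ⟨g, hg⟩ := exists_dotProduct_mulVec_lt_of_le (K := (reducedGram A ψ).map norm)
    (L := L.submatrix e e) hle (fun y z => hL (e y) (e z)) hlt hf₀ hf
  have hgg : 0 ≤ g ⬝ᵥ g := Finset.sum_nonneg fun y _ => mul_self_nonneg (g y)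
  refine lt_of_mul_lt_mul_right ?_ hgg
  calc maxOverlap A ψ * (g ⬝ᵥ g)
      ≤ f ⬝ᵥ (reducedGram A ψ).map norm *ᵥ f * (g ⬝ᵥ g) := by gcongr
    _ < g ⬝ᵥ L.submatrix e e *ᵥ g := hg
    _ = (g ∘ e.symm) ⬝ᵥ L *ᵥ (g ∘ e.symm) := by
      rw [submatrix_mulVec_equiv, dotProduct_comm, ← dotProduct_comp_equiv_symm, dotProduct_comm]
    _ ≤ maxOverlap A' ψ' * ((g ∘ e.symm) ⬝ᵥ (g ∘ e.symm)) :=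
      dotProduct_mulVec_le_maxOverlap_mul hψ' _
    _ = maxOverlap A' ψ' * (g ⬝ᵥ g) := by rw [comp_equiv_dotProduct_comp_equiv]

end Bipartition

section MultipartiteEntanglement

variable {d : ℕ} {V : Type*} [Fintype V] [DecidableEq V]

theorem multipartiteEntanglement_le (ψ : QuditSpace d V) {A : Finset V} (hA : A.Nonempty)
    (hAc : Aᶜ.Nonempty) : multipartiteEntanglement ψ ≤ bipartiteEntanglement A ψ :=
  ciInf_le (Set.finite_range _).bddBelow
    (⟨A, hA, hAc⟩ : {A : Finset V // A.Nonempty ∧ Aᶜ.Nonempty})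

theorem exists_multipartiteEntanglement_eq [Nontrivial V] (ψ : QuditSpace d V) :
    ∃ A : Finset V, A.Nonempty ∧ Aᶜ.Nonempty ∧
      multipartiteEntanglement ψ = bipartiteEntanglement A ψ := by
  obtain ⟨v, w, hvw⟩ := exists_pair_ne V
  have : Nonempty {A : Finset V // A.Nonempty ∧ Aᶜ.Nonempty} :=
    ⟨{v}, Finset.singleton_nonempty v, w, by simpa using hvw.symm⟩
  obtain ⟨⟨A, hA, hAc⟩, h⟩ := exists_eq_ciInf_of_finite
    (f := fun A : {A : Finset V // A.Nonempty ∧ Aᶜ.Nonempty} => bipartiteEntanglement A.1 ψ)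
  exact ⟨A, hA, hAc, h.symm⟩

end MultipartiteEntanglement

section ElementaryState

theorem controlledPhase_pow_apply {d : ℕ} {V : Type*} [Fintype V] [DecidableEq V]
    (e : Finset V) (m : ℕ) (ψ : QuditSpace d V) (q : V → Fin d) :
    (controlledPhase d e ^ m) ψ q = rootOmega d ^ (m * ∏ i ∈ e, (q i : ℕ)) * ψ q := by
  induction m generalizing ψ with
  | zero => simp
  | succ m ih =>
    rw [pow_succ, Module.End.mul_apply, ih, controlledPhase, Matrix.toLpLin_apply]
    simp [Matrix.mulVec_diagonal, add_mul, pow_add, mul_assoc]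

/-- The product of the levels of the basis state `q`, as a residue modulo `d`. -/
def levelProd {d : ℕ} {ι : Type*} [Fintype ι] (q : ι → Fin d) : ZMod d :=
  ∏ i, ((q i : ℕ) : ZMod d)

theorem levelProd_comp_equiv {d : ℕ} {ι κ : Type*} [Fintype ι] [Fintype κ] (e : κ ≃ ι)
    (q : ι → Fin d) : levelProd (q ∘ e) = levelProd q :=
  e.prod_comp fun i => ((q i : ℕ) : ZMod d)

theorem levelProd_mul_levelProd {d : ℕ} {V : Type*} [Fintype V] [DecidableEq V] (A : Finset V)
    (x : {i // i ∈ A} → Fin d) (y : {i // i ∉ A} → Fin d) :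
    levelProd x * levelProd y =
      levelProd ((Equiv.piEquivPiSubtypeProd (· ∈ A) fun _ => Fin d).symm (x, y)) := by
  rw [← levelProd_comp_equiv (Equiv.sumCompl (· ∈ A)), levelProd, levelProd, levelProd,
    Fintype.prod_sum_type]
  congr 1 <;> refine Finset.prod_congr rfl fun i _ => ?_ <;> simp [i.2]

variable {d : ℕ} [NeZero d]

theorem natCast_fin_bijective : Function.Bijective fun q : Fin d => ((q : ℕ) : ZMod d) := by
  refine (Fintype.bijective_iff_injective_and_card _).2 ⟨fun p q h => Fin.ext ?_, by simp⟩
  exact ((ZMod.natCast_eq_natCast_iff _ _ _).1 h).eq_of_lt_of_lt p.2 q.2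

theorem levelProd_surjective {ι : Type*} [Fintype ι] [Nonempty ι] :
    Function.Surjective (levelProd : (ι → Fin d) → ZMod d) := by
  classical
  intro t
  obtain ⟨i⟩ := ‹Nonempty ι›
  choose q hq using fun j => natCast_fin_bijective.2 (Pi.mulSingle (M := fun _ => ZMod d) i t j)
  exact ⟨q, by simp [levelProd, hq]⟩

theorem sum_stdAddChar_mul_levelProd {ι : Type*} [Fintype ι] [DecidableEq ι] {a : ℕ}
    (hι : Fintype.card ι = a + 1) (s : ZMod d) :
    ∑ x : ι → Fin d, ZMod.stdAddChar (s * levelProd x) = (d * annihilatorCount a s : ℂ) := by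
  have hsum := sum_addChar_mul_prod (ZMod.isPrimitive_stdAddChar d) a s
  rw [ZMod.card] at hsum
  rw [← hsum]
  let e := Fintype.equivFinOfCardEq hι
  let residues := Equiv.ofBijective _ (natCast_fin_bijective (d := d))
  refine Fintype.sum_equiv (e.arrowCongr residues) _ _ fun x => ?_
  rw [levelProd, ← e.symm.prod_comp]
  rfl

theorem stdAddChar_natCast (k : ℕ) : ZMod.stdAddChar (k : ZMod d) = rootOmega d ^ k := by
  rw [rootOmega, ← Complex.exp_nat_mul, ← Int.cast_natCast, ZMod.stdAddChar_coe]
  push_cast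
  ring_nf

theorem elementaryState_apply (n m : ℕ) (q : Fin n → Fin d) :
    elementaryState d n m q = (√d : ℂ)⁻¹ ^ n * ZMod.stdAddChar ((m : ZMod d) * levelProd q) := by
  have hphase : ((m : ZMod d) * levelProd q) = ((m * ∏ i, (q i : ℕ) : ℕ) : ZMod d) := by
    simp [levelProd]
  rw [elementaryState, controlledPhase_pow_apply, hphase, stdAddChar_natCast, mul_comm]
  simp [plusState, plusLocal]

theorem reducedGram_elementaryState {n : ℕ} (m : ℕ) {a : ℕ} {A : Finset (Fin n)}
    (hA : A.card = a + 1) (y z : {i // i ∉ A} → Fin d) :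
    reducedGram A (elementaryState d n m) y z =
      ((d * annihilatorCount a (m * (levelProd z - levelProd y)) / d ^ n : ℝ) : ℂ) := by
  have hd₀ : star ((√d : ℂ)⁻¹ ^ n) * (√d : ℂ)⁻¹ ^ n = ((d : ℂ) ^ n)⁻¹ := by
    rw [star_pow, ← mul_pow, ← inv_pow]
    congr 1
    rw [star_inv₀, RCLike.star_def, Complex.conj_ofReal, ← mul_inv, ← Complex.ofReal_mul,
      Real.mul_self_sqrt (Nat.cast_nonneg d), Complex.ofReal_natCast]
  have hterm (x : {i // i ∈ A} → Fin d) :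
      star (coeffMatrix A (elementaryState d n m) x y) * coeffMatrix A (elementaryState d n m) x z =
        ((d : ℂ) ^ n)⁻¹ *
          ZMod.stdAddChar ((m : ZMod d) * (levelProd z - levelProd y) * levelProd x) := by
    have hphase : ((m : ZMod d) * (levelProd z - levelProd y) * levelProd x) =
        -(m * (levelProd x * levelProd y)) + m * (levelProd x * levelProd z) := by ring
    simp only [coeffMatrix, of_apply, elementaryState_apply, ← levelProd_mul_levelProd]
    rw [← hd₀, hphase, AddChar.map_add_eq_mul, AddChar.map_neg_eq_conj, star_mul', RCLike.star_def]
    ring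
  simp only [reducedGram, mul_apply, conjTranspose_apply, hterm]
  rw [← Finset.mul_sum, sum_stdAddChar_mul_levelProd (by simpa using hA)]
  push_cast
  ring

theorem norm_reducedGram_elementaryState {n : ℕ} (m : ℕ) {a : ℕ} {A : Finset (Fin n)}
    (hA : A.card = a + 1) (y z : {i // i ∉ A} → Fin d) :
    ‖reducedGram A (elementaryState d n m) y z‖ =
      (Fintype.card (ZMod d) * annihilatorCount a (m * (levelProd z - levelProd y)) : ℕ) /
        d ^ n := by
  rw [reducedGram_elementaryState m hA, Complex.norm_real, Real.norm_of_nonneg (by positivity),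
    ZMod.card, Nat.cast_mul]

theorem maxOverlap_elementaryState_lt {n m : ℕ} (hm : ¬ d ∣ m) {A : Finset (Fin n)}
    (hA : A.Nonempty) (hAc : Aᶜ.Nonempty) {A' : Finset (Fin (n + 1))} (hA' : A'.card = A.card + 1) :
    maxOverlap A (elementaryState d n m) < maxOverlap A' (elementaryState d (n + 1) m) := by
  obtain ⟨a, ha⟩ := Nat.exists_eq_add_one_of_ne_zero hA.card_ne_zero
  have hm₀ : (m : ZMod d) ≠ 0 := fun h => hm ((ZMod.natCast_eq_zero_iff m d).1 h)
  have hcard : Fintype.card {i // i ∉ A'} = Fintype.card {i // i ∉ A} := by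
    simp [Fintype.card_subtype_compl, hA']
  let σ := Fintype.equivOfCardEq hcard
  let e : ({i // i ∉ A} → Fin d) ≃ ({i // i ∉ A'} → Fin d) := σ.symm.arrowCongr (Equiv.refl _)
  have hprod (y) : levelProd (e y) = levelProd y := levelProd_comp_equiv σ y
  have hd : 0 < (d : ℝ) := Nat.cast_pos.2 (NeZero.pos d)
  have : Nonempty {i // i ∉ A} := by simpa [Finset.Nonempty] using hAc
  obtain ⟨y₀, hy₀⟩ := levelProd_surjective (ι := {i // i ∉ A}) (0 : ZMod d)
  obtain ⟨z₀, hz₀⟩ := levelProd_surjective (ι := {i // i ∉ A}) (1 : ZMod d)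
  refine maxOverlap_lt_of_reducedGram_lt e (y₀ := y₀) (z₀ := z₀)
    (L := of fun y z => (annihilatorCount (a + 1) (m * (levelProd z - levelProd y)) / d ^ n : ℝ))
    ?_ (fun y z => ?_) (fun y z => ?_) ?_
  · ext y z
    rw [reducedGram_elementaryState m (hA'.trans (congrArg (· + 1) ha)), pow_succ',
      mul_div_mul_left _ _ hd.ne']
    rfl
  · exact div_pos (Nat.cast_pos.2 (annihilatorCount_succ_pos _ _)) (by positivity)
  · rw [norm_reducedGram_elementaryState m ha, of_apply, hprod, hprod]
    gcongr
    exact card_mul_annihilatorCount_le_succ _ _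
  · rw [norm_reducedGram_elementaryState m ha, of_apply, hprod, hprod, hy₀, hz₀,
      sub_zero, mul_one]
    gcongr
    exact card_mul_annihilatorCount_lt_succ _ hm₀

end ElementaryState

theorem mainTheorem5 (d : ℕ) (hd : 2 ≤ d) (m : ℕ) (hm : ¬ d ∣ m) (n : ℕ) (hn : 2 ≤ n) :
    multipartiteEntanglement (elementaryState d (n + 1) m) <
      multipartiteEntanglement (elementaryState d n m) := by
  have : NeZero d := ⟨by omega⟩
  have : Nontrivial (Fin n) := Fin.nontrivial_iff_two_le.2 hn
  obtain ⟨A, hA, hAc, hmin⟩ := exists_multipartiteEntanglement_eq (elementaryState d n m)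
  let A' : Finset (Fin (n + 1)) := Finset.cons (Fin.last n) (A.map Fin.castSuccEmb) (by simp)
  have hA'c : A'ᶜ.Nonempty := by
    obtain ⟨i, hi⟩ := hAc
    exact ⟨i.castSucc, by simpa [A', Fin.castSucc_ne_last] using hi⟩
  have hoverlap :
      maxOverlap A (elementaryState d n m) < maxOverlap A' (elementaryState d (n + 1) m) :=
    maxOverlap_elementaryState_lt hm hA hAc (by simp [A'])
  calc multipartiteEntanglement (elementaryState d (n + 1) m)
      ≤ bipartiteEntanglement A' (elementaryState d (n + 1) m) :=
        multipartiteEntanglement_le _ (Finset.cons_nonempty _) hA'c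
    _ < bipartiteEntanglement A (elementaryState d n m) := sub_lt_sub_left hoverlap 1
    _ = multipartiteEntanglement (elementaryState d n m) := hmin.symm
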